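/- Let $p$ be a prime number, $\mathbb Z[\rho]=\mathbb Z[x]/(x^{p-1}+\cdots+x+1)$ with $\rho$ the image of $x$, and $\eta=\rho-1$. Put $b_i=\frac1p\binom pi$, $y=\sum_{i=1}^{p-1}b_i\eta^{i-1}$ (a unit of $\mathbb Z[\rho]$), $x=-1/y$ (so that $p=x\eta^{p-1}$), and $g(Z)=x\sum_{i=1}^{p-1}b_i\eta^{i-1}Z^i$. Let $\tau$ generate the automorphism group of $\mathbb Z[\rho]$ (that is, the Galois group of $\mathbb Q(\rho)/\mathbb Q$), and let $s,r$ be natural numbers with $\tau(\rho)=\rho^s$ and $s^{p-1}-1=pr$, $r$ prime to $p$. Let $\delta=(\rho^s-1)/(\rho-1)=1+\rho+\cdots+\rho^{s-1}$, which is a unit of $\mathbb Z[\rho]$. In a commutative $\mathbb Z[\rho]$-algebra put $a\oplus b=a+b+ab\eta$, so that $1+(a\oplus b)\eta=(1+a\eta)(1+b\eta)$; if $1+b\eta$ is a unit, let $a\ominus b$ be the unique $c$ with $a=b\oplus c$; and let $n*a=a\oplus\cdots\oplus a$ ($n$ times). Let $\oplus_p$ and $*_p$ be the same operations with $\eta^p$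 in place of $\eta$. Extend $\tau$ to $\mathbb Z[\rho][x_0,\dots,x_{p-2}]$ by $\tau(x_i)=x_i$. Let $z=\sum_{i=0}^{p-2}x_i\rho^i$, $C=\prod_{i=0}^{p-2}\tau^i(1+z\eta^p)$ and $R=\mathbb Z[\rho][x_0,\dots,x_{p-2}](1/C)$; since $\tau(C)=C$, $\tau$ acts on $R$. Let $$u=N(z)=(s^{p-2}*_pz)\oplus_p(s^{p-3}*_p\delta^p\tau(z))\oplus_p\cdots\oplus_p(\delta^p\tau)^{p-2}(z),$$ where $\delta^p\tau$ denotes the map $a\mapsto\delta^p\tau(a)$, let $S=R[Z]/(Z^p+g(Z)-u)$, and let $\theta$ be the image of $Z$ in $S$. A ring extension $B/A$ is called Galois with finite group $G$ of $A$-algebra automorphisms of $B$ if $B^G=A$ and there are $a_1,\dots,a_n,c_1,\dots,c_n\in B$ with $\sum_i a_ic_i=1$ and $\sum_i a_i\,h(c_i)=0$ for all $1\ne h\in G$. Then there is an $R$-algebra automorphism $\sigma$ of $S$ with $\sigma(\theta)=\rho\theta+1$, and $S/R$ is Galois with group $\langle\sigma\rangle$. The formula $$\tau(\theta)=\frac1\delta\bigl((s*\theta)\ominus(r*_pz)\eta^{p-1}\bigr)$$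 defines an extension of the automorphism $\tau$ of $R$ to a ring automorphism $\tau$ of $S$, with $\tau^{p-1}=1$ and $\tau\sigma=\sigma\tau$. Moreover $\sigma$ restricts to an automorphism of $S^\tau$ over $R^\tau$ which generates a group of order $p$, and $S^\tau/R^\tau$ is Galois with this group $\langle\sigma\rangle\cong C_p$. If $p\ne2$, then $R/R^\tau$ is ramified, that is, $R$ is not (formally) unramified over $R^\tau$. -/

import Mathlib

open Polynomial

noncomputable section

namespace MixedArtinSchreier

/-! ### Galois extensions of commutative rings -/

/-- `S/R` is a Galois extension of commutative rings with (finite) group `G`, in the sense of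
Auslander-Goldman and Chase-Harrison-Rosenberg: `R` embeds in `S`, `S ^ G = R`, and there are
`x₁, …, xₙ, y₁, …, yₙ` in `S` with `∑ xᵢ g(yᵢ) = 1` for `g = 1` and `= 0` for `1 ≠ g ∈ G`.
(That `R` is fixed by `G` is part of the type of `G`.) -/
structure IsGaloisWithGroup (R S : Type*) [CommRing R] [CommRing S] [Algebra R S]
    (G : Subgroup (S ≃ₐ[R] S)) : Prop where
  finite : Finite G
  injective : Function.Injective (algebraMap R S)
  fixed : ∀ b : S, (∀ g ∈ G, g b = b) → ∃ a : R, algebraMap R S a = b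
  coordinates : ∃ (n : ℕ) (x y : Fin n → S),
    (∑ i, x i * y i = 1) ∧ ∀ g ∈ G, g ≠ 1 → ∑ i, x i * g (y i) = 0

/-- The subring `A ^ f` of elements fixed by a ring automorphism `f` of `A`. -/
def fixedSubring {A : Type*} [CommRing A] (f : A ≃+* A) : Subring A where
  carrier := {a | f a = a}
  mul_mem' {a b} ha hb := by
    simp only [Set.mem_ofPred_eq] at ha hb ⊢
    rw [map_mul, ha, hb]
  one_mem' := map_one f
  add_mem' {a b} ha hb := by
    simp only [Set.mem_ofPred_eq] at ha hb ⊢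
    rw [map_add, ha, hb]
  zero_mem' := map_zero f
  neg_mem' {a} ha := by
    simp only [Set.mem_ofPred_eq] at ha ⊢
    rw [map_neg, ha]

theorem mem_fixedSubring {A : Type*} [CommRing A] {f : A ≃+* A} {a : A} :
    a ∈ fixedSubring f ↔ f a = a := Iff.rfl

/-- If the automorphism `g` of the `A`-algebra `B` extends the automorphism `f` of `A`,
then `B ^ g` is an algebra over `A ^ f` by restriction of `A → B`. -/
abbrev fixedAlgebra {A B : Type*} [CommRing A] [CommRing B] [Algebra A B] (f : A ≃+* A)
    (g : B ≃+* B) (h : ∀ a : A, g (algebraMap A B a) = algebraMap A B (f a)) :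
    Algebra (fixedSubring f) (fixedSubring g) :=
  ((algebraMap A B).restrict (fixedSubring f) (fixedSubring g) (fun a ha => by
    rw [mem_fixedSubring] at ha ⊢
    rw [h, ha])).toAlgebra

/-! ### The operations `⊕`, `⊖`, `*`

They are transported from multiplication along `φ x = 1 + x e`. With `e = η` they are the
operations `⊕, ⊖, *`, and with `e = η ^ p` they are `⊕_p, ⊖_p, *_p`. -/

section Operations

variable {A : Type*} [CommRing A]

/-- `x ⊕ y = x + y + x y e`, that is, `1 + (x ⊕ y) e = (1 + x e) (1 + y e)`. -/
def oplus (e x y : A) : A := x + y + x * y * e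

/-- `x ⊖ y`, the solution `z` of `x = y ⊕ z`, provided that `1 + y e` is a unit. -/
def ominus (e x y : A) : A := (x - y) * Ring.inverse (1 + y * e)

/-- `f 0 ⊕ f 1 ⊕ ⋯ ⊕ f (n - 1)`. -/
def oplusSum (e : A) (f : ℕ → A) : ℕ → A
  | 0 => 0
  | n + 1 => oplus e (oplusSum e f n) (f n)

/-- `n * x = x ⊕ ⋯ ⊕ x` (`n` times). -/
def starOp (e : A) (n : ℕ) (x : A) : A := oplusSum e (fun _ => x) n

theorem one_add_oplus (e x y : A) : 1 + oplus e x y * e = (1 + x * e) * (1 + y * e) := by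
  unfold oplus; ring

theorem ominus_eq_iff (e x y z : A) (h : IsUnit (1 + y * e)) :
    ominus e x y = z ↔ x = oplus e y z := by
  have h' : (1 + y * e) * Ring.inverse (1 + y * e) = 1 := Ring.mul_inverse_cancel _ h
  unfold ominus oplus
  constructor
  · rintro rfl
    linear_combination (y - x) * h'
  · intro hx
    rw [hx]
    linear_combination z * h'

theorem one_add_starOp (e : A) (n : ℕ) (x : A) : 1 + starOp e n x * e = (1 + x * e) ^ n := by
  unfold starOp
  induction n with
  | zero => simp [oplusSum]
  | succ n ih => rw [oplusSum, one_add_oplus, ih, pow_succ]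

end Operations

/-! ### The ring `ℤ[ρ]` -/

/-- `ℤ[ρ] = ℤ[x]/(x ^ (p - 1) + ⋯ + x + 1)`, for a prime number `p`. -/
abbrev CycInt (p : ℕ) : Type := AdjoinRoot (cyclotomic p ℤ)

/-- The root of unity `ρ`. -/
def rho (p : ℕ) : CycInt p := AdjoinRoot.root (cyclotomic p ℤ)

/-- `η = ρ - 1`. -/
def eta (p : ℕ) : CycInt p := rho p - 1

/-- `bᵢ = (p choose i) / p`, an integer for `1 ≤ i ≤ p - 1`. -/
def binomQuot (p i : ℕ) : ℕ := p.choose i / p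

/-- `y = ∑_{1 ≤ i ≤ p - 1} bᵢ η ^ (i - 1)`. -/
def yElt (p : ℕ) : CycInt p := ∑ i ∈ Finset.Icc 1 (p - 1), (binomQuot p i : CycInt p) * eta p ^ (i - 1)

/-- `x = - 1 / y`, so that `p = x η ^ (p - 1)`. -/
def xElt (p : ℕ) : CycInt p := -Ring.inverse (yElt p)

/-- `g(Z) = x ∑_{1 ≤ i ≤ p - 1} bᵢ η ^ (i - 1) Z ^ i`. -/
def gPoly (p : ℕ) : (CycInt p)[X] :=
  C (xElt p) * ∑ i ∈ Finset.Icc 1 (p - 1), C ((binomQuot p i : CycInt p) * eta p ^ (i - 1)) * X ^ i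

theorem rho_pow (p : ℕ) [Fact p.Prime] : rho p ^ p = 1 := by
  have h : eval₂ (AdjoinRoot.of (cyclotomic p ℤ)) (AdjoinRoot.root _) (cyclotomic p ℤ) = 0 :=
    AdjoinRoot.eval₂_root _
  obtain ⟨q, hq⟩ := cyclotomic.dvd_X_pow_sub_one p ℤ
  have := congrArg (eval₂ (AdjoinRoot.of (cyclotomic p ℤ)) (AdjoinRoot.root _)) hq
  rw [eval₂_mul, h, zero_mul] at this
  rw [eval₂_sub, eval₂_X_pow, eval₂_one] at this
  exact sub_eq_zero.1 this

instance (p : ℕ) [hp : Fact p.Prime] : IsDomain (CycInt p) :=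
  AdjoinRoot.isDomain_of_prime (cyclotomic.irreducible hp.out.pos).prime

theorem rho_isPrimitiveRoot (p : ℕ) [hp : Fact p.Prime] : IsPrimitiveRoot (rho p) p := by
  have : CharZero (CycInt p) := by
    refine charZero_of_injective_algebraMap (R := ℤ) ?_
    refine AdjoinRoot.of.injective_of_degree_ne_zero ?_
    exact (degree_cyclotomic_pos p ℤ hp.out.pos).ne'
  have : NeZero (p : CycInt p) := ⟨by exact_mod_cast hp.out.ne_zero⟩
  refine isRoot_cyclotomic_iff.1 ?_
  have h : ((cyclotomic p ℤ).map (Int.castRingHom (CycInt p))).IsRoot (rho p) := by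
    rw [IsRoot.def, eval_map, RingHom.ext_int (Int.castRingHom (CycInt p))
      (AdjoinRoot.of (cyclotomic p ℤ))]
    exact AdjoinRoot.eval₂_root _
  rwa [map_cyclotomic_int] at h

/-- The defining property `p = x η ^ (p - 1)`; it also shows that the inverse of `y` in the
definition of `x` is a true inverse. -/
theorem isUnit_yElt_and_eq (p : ℕ) [hp : Fact p.Prime] :
    IsUnit (yElt p) ∧ (p : CycInt p) = xElt p * eta p ^ (p - 1) := by
  have hp1 : p - 1 + 1 = p := Nat.sub_add_cancel hp.out.one_lt.le
  have h0 : eta p ≠ 0 := (rho_isPrimitiveRoot p).sub_one_ne_zero hp.out.one_lt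
  have hy : eta p ^ p + p * eta p * yElt p = 0 := by
    have h1 : (eta p + 1) ^ p = 1 := by
      rw [eta, sub_add_cancel, rho_pow]
    have h2 : ∑ m ∈ Finset.range (p - 1), eta p ^ (m + 1) * (p.choose (m + 1) : CycInt p)
        = p * eta p * yElt p := by
      rw [yElt, Finset.mul_sum, Finset.range_eq_Ico, Finset.sum_Ico_add' (fun m =>
        eta p ^ m * (p.choose m : CycInt p)) 0 (p - 1) 1]
      refine Finset.sum_congr (by ext; simp) ?_
      intro i hi
      rw [Finset.mem_Icc] at hi
      have h3 : p * binomQuot p i = p.choose i :=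
        Nat.mul_div_cancel' (hp.out.dvd_choose_self (by omega) (by omega))
      rw [← h3]
      obtain ⟨j, rfl⟩ : ∃ j, i = j + 1 := ⟨i - 1, by omega⟩
      push_cast
      ring
    rw [add_pow] at h1
    simp only [one_pow, mul_one] at h1
    rw [Finset.sum_range_succ] at h1
    have h3 := Finset.sum_range_succ' (fun m => eta p ^ m * (p.choose m : CycInt p)) (p - 1)
    simp only [hp1] at h3
    rw [h3, h2] at h1
    simp only [pow_zero, Nat.choose_self, Nat.choose_zero_right, Nat.cast_one, mul_one] at h1
    linear_combination h1
  obtain ⟨w, -, hw⟩ := (rho_isPrimitiveRoot p).self_sub_one_pow_dvd_order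
    (Nat.sub_lt hp.out.pos one_pos)
  change (p : CycInt p) = w * eta p ^ (p - 1) at hw
  have hη : eta p ^ p = eta p ^ (p - 1) * eta p := by rw [← pow_succ, hp1]
  have hwy : yElt p * (-w) = 1 := by
    have h3 : eta p ^ p * (1 + w * yElt p) = 0 := by
      rw [hw] at hy
      rw [hη] at hy ⊢
      linear_combination hy
    have h4 := (mul_eq_zero.1 h3).resolve_left (pow_ne_zero _ h0)
    linear_combination -h4
  have hu : IsUnit (yElt p) := IsUnit.of_mul_eq_one _ hwy
  refine ⟨hu, ?_⟩
  have h5 : Ring.inverse (yElt p) = -w := by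
    rw [← mul_one (Ring.inverse (yElt p)), ← hwy, Ring.inverse_mul_cancel_left _ _ hu]
  rw [xElt, h5, neg_neg, hw]

/-! ### The generator `τ` -/

/-- A generator `τ` of the group of automorphisms of `ℤ[ρ]`, which is the Galois group of
`ℚ(ρ)/ℚ`, with natural numbers `s`, `r` such that `τ(ρ) = ρ ^ s` and `s ^ (p - 1) - 1 = p r`,
with `r` prime to `p`. -/
structure TauData (p : ℕ) where
  τ : CycInt p ≃+* CycInt p
  generates : ∀ g : CycInt p ≃+* CycInt p, g ∈ Subgroup.zpowers τ
  s : ℕ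
  r : ℕ
  τ_rho : τ (rho p) = rho p ^ s
  s_pow : s ^ (p - 1) = 1 + p * r
  coprime : r.Coprime p

namespace TauData

variable {p : ℕ} (D : TauData p)

/-- `δ = 1 + ρ + ⋯ + ρ ^ (s - 1) = (ρ ^ s - 1) / (ρ - 1)`. -/
def delta : CycInt p := ∑ i ∈ Finset.range D.s, rho p ^ i

theorem isUnit_delta [hp : Fact p.Prime] : IsUnit D.delta := by
  refine (rho_isPrimitiveRoot p).geom_sum_isUnit hp.out.two_le ?_
  rw [Nat.coprime_comm, hp.out.coprime_iff_not_dvd]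
  intro h
  have h1 : p ∣ D.s ^ (p - 1) := dvd_pow h (Nat.sub_pos_of_lt hp.out.one_lt).ne'
  rw [D.s_pow] at h1
  exact hp.out.one_lt.ne' (Nat.dvd_one.1 ((Nat.dvd_add_left (dvd_mul_right p D.r)).1 h1))

theorem τ_pow [Fact p.Prime] : D.τ ^ (p - 1) = 1 := by
  have h : ∀ k : ℕ, (D.τ ^ k) (rho p) = rho p ^ D.s ^ k := by
    intro k
    induction k with
    | zero => simp
    | succ k ih =>
      rw [pow_succ', RingAut.mul_apply, ih, map_pow, D.τ_rho, ← pow_mul, ← pow_succ']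
  have h1 : (D.τ ^ (p - 1)) (rho p) = rho p := by
    rw [h, D.s_pow, pow_add, pow_mul, rho_pow, one_pow, pow_one, mul_one]
  have h2 : ((D.τ ^ (p - 1) : CycInt p ≃+* CycInt p) : CycInt p →+* CycInt p)
      = RingHom.id (CycInt p) := by
    refine AdjoinRoot.ringHom_ext (RingHom.ext_int _ _) ?_
    exact h1
  ext a
  exact RingHom.congr_fun h2 a

/-! ### The generic ring `R` -/

/-- `τ` acting on `ℤ[ρ][x₀, …, x_{p-2}]` with `τ(xᵢ) = xᵢ`. -/
def τPoly : MvPolynomial (Fin (p - 1)) (CycInt p) ≃+* MvPolynomial (Fin (p - 1)) (CycInt p) :=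
  MvPolynomial.mapEquiv (Fin (p - 1)) D.τ

end TauData

/-- The generic element `z = ∑ xᵢ ρ ^ i` of `ℤ[ρ][x₀, …, x_{p-2}]`. -/
def zPoly (p : ℕ) : MvPolynomial (Fin (p - 1)) (CycInt p) :=
  ∑ i : Fin (p - 1), MvPolynomial.X i * MvPolynomial.C (rho p ^ (i : ℕ))

namespace TauData

variable {p : ℕ} (D : TauData p)

/-- The norm `C = ∏_{0 ≤ i ≤ p - 2} τ ^ i (1 + z η ^ p)`. -/
def normC : MvPolynomial (Fin (p - 1)) (CycInt p) :=
  ∏ i ∈ Finset.range (p - 1), (D.τPoly ^ i) (1 + zPoly p * MvPolynomial.C (eta p ^ p))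

/-- `R = ℤ[ρ][x₀, …, x_{p-2}](1/C)`. -/
abbrev BaseRing : Type := Localization.Away D.normC

theorem τPoly_pow [Fact p.Prime] : D.τPoly ^ (p - 1) = 1 := by
  have h : ∀ (k : ℕ) a, (D.τPoly ^ k) a
      = MvPolynomial.map ((D.τ ^ k : CycInt p ≃+* CycInt p) : CycInt p →+* CycInt p) a := by
    intro k
    induction k with
    | zero =>
      intro a
      exact (MvPolynomial.map_id a).symm
    | succ k ih =>
      intro a
      rw [pow_succ', RingAut.mul_apply, ih, pow_succ']
      exact MvPolynomial.map_map _ _ a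
  ext1 a
  rw [h, D.τ_pow]
  exact MvPolynomial.map_id a

theorem prod_shift {M : Type*} [CommMonoid M] (F : ℕ → M) (n : ℕ) (h : F n = F 0) :
    ∏ i ∈ Finset.range n, F (i + 1) = ∏ i ∈ Finset.range n, F i := by
  cases n with
  | zero => rfl
  | succ m => rw [Finset.prod_range_succ, Finset.prod_range_succ', h]

theorem τPoly_normC [Fact p.Prime] : D.τPoly D.normC = D.normC := by
  unfold normC
  rw [map_prod]
  have h : ∀ i a, D.τPoly ((D.τPoly ^ i) a) = (D.τPoly ^ (i + 1)) a := by
    intro i a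
    rw [pow_succ', RingAut.mul_apply]
  simp only [h]
  refine prod_shift (fun i => (D.τPoly ^ i) (1 + zPoly p * MvPolynomial.C (eta p ^ p))) _ ?_
  rw [D.τPoly_pow, pow_zero]

/-- `τ` acting on `R`. -/
def τR [Fact p.Prime] : D.BaseRing ≃+* D.BaseRing :=
  IsLocalization.ringEquivOfRingEquiv (M := Submonoid.powers D.normC)
    (T := Submonoid.powers D.normC) D.BaseRing D.BaseRing D.τPoly (by
      rw [Submonoid.map_powers]
      exact congrArg Submonoid.powers D.τPoly_normC)

/-- The element `z` of `R`. -/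
def z : D.BaseRing := algebraMap _ D.BaseRing (zPoly p)

/-- `η` in `R`. -/
def etaR : D.BaseRing := algebraMap (CycInt p) D.BaseRing (eta p)

/-- `1 + z η ^ p` is a unit of `R`, so that the `⊖` used below is a true subtraction. -/
theorem isUnit_one_add_z [Fact p.Prime] : IsUnit (1 + D.z * D.etaR ^ p) := by
  have h1 : 0 ∈ Finset.range (p - 1) :=
    Finset.mem_range.2 (Nat.sub_pos_of_lt (Fact.out : p.Prime).one_lt)
  have h2 : (1 + zPoly p * MvPolynomial.C (eta p ^ p)) ∣ D.normC := by
    have := Finset.dvd_prod_of_mem (fun i => (D.τPoly ^ i)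
      (1 + zPoly p * MvPolynomial.C (eta p ^ p))) h1
    rwa [pow_zero] at this
  have h3 := isUnit_of_dvd_unit
    (map_dvd (algebraMap (MvPolynomial (Fin (p - 1)) (CycInt p)) D.BaseRing) h2)
    (IsLocalization.Away.algebraMap_isUnit D.normC)
  have h4 : algebraMap (MvPolynomial (Fin (p - 1)) (CycInt p)) D.BaseRing
      (MvPolynomial.C (eta p ^ p)) = D.etaR ^ p := by
    rw [etaR, ← map_pow, IsScalarTower.algebraMap_apply (CycInt p)
      (MvPolynomial (Fin (p - 1)) (CycInt p)) D.BaseRing]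
    rfl
  rw [map_add, map_mul, map_one, h4] at h3
  exact h3

/-- `δ` in `R`. -/
def deltaR : D.BaseRing := algebraMap (CycInt p) D.BaseRing D.delta

/-- `N(x) = (s ^ (p-2) *_p x) ⊕_p (s ^ (p-3) *_p δ ^ p τ(x)) ⊕_p ⋯ ⊕_p (δ ^ p τ) ^ (p-2) (x)`. -/
def N [Fact p.Prime] (x : D.BaseRing) : D.BaseRing :=
  oplusSum (D.etaR ^ p)
    (fun i => starOp (D.etaR ^ p) (D.s ^ (p - 2 - i)) ((fun a => D.deltaR ^ p * D.τR a)^[i] x))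
    (p - 1)

/-! ### The extension `S` -/

/-- The polynomial `Z ^ p + g(Z) - u` over `R`, with `u = N(z)`. -/
def poly [Fact p.Prime] : D.BaseRing[X] :=
  X ^ p + (gPoly p).map (algebraMap (CycInt p) D.BaseRing) - C (D.N D.z)

/-- `S = R[Z]/(Z ^ p + g(Z) - u)`. -/
abbrev ExtRing [Fact p.Prime] : Type := AdjoinRoot D.poly

/-- The image `θ` of `Z` in `S`. -/
def theta [Fact p.Prime] : D.ExtRing := AdjoinRoot.root D.poly

/-- The element `(1/δ) ((s * θ) ⊖ (r *_p z) η ^ (p-1))` of `S`. -/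
def tauTheta [Fact p.Prime] : D.ExtRing :=
  Ring.inverse (algebraMap D.BaseRing D.ExtRing D.deltaR) *
    ominus (algebraMap D.BaseRing D.ExtRing D.etaR)
      (starOp (algebraMap D.BaseRing D.ExtRing D.etaR) D.s D.theta)
      (algebraMap D.BaseRing D.ExtRing (starOp (D.etaR ^ p) D.r D.z * D.etaR ^ (p - 1)))

end TauData

end MixedArtinSchreier

end

/-!
Put `ω = 1 + θ η`, `c = 1 + z η ^ p` and `U = 1 + u η ^ p`. Because `p = x η ^ (p - 1)`, multiplying
`Z ^ p + g(Z) - u` by `η ^ p` gives `(1 + Z η) ^ p - U` (`eval₂_poly_mul`), so that `ω ^ p = U`, a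
unit. Since `R` is a domain and `S` is free over it, `η` is regular on `S`, and all identities in
`S` may be checked on the Kummer generator `ω`. There `σ` is `ω ↦ ρ ω`, so `σ ^ p = 1`, and `τ` is
`ω ↦ ω ^ s / c ^ r`, which is consistent because `U = ∏ τ ^ i (c) ^ (s ^ (p - 2 - i))` satisfies
`U ^ s = τ(U) c ^ (p r)` (`partialNorm_pow_s`). The same telescoping shows `τ ^ (p - 1) = 1`.

The differences `θ - σ ^ i θ`, for `i` prime to `p`, are `ω` times cyclotomic units
(`theta_sub_sigma_pow_theta`). This gives Galois coordinates for `S/R` (`exists_coordinates`), and,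
through a Vandermonde determinant, `S ^ σ = R` (`exists_algebraMap_eq_of_sigma_eq`).

Galois descent does not apply to `S ^ τ / R ^ τ`, since `R / R ^ τ` ramifies for odd `p`.
Instead, the order of `τ` being prime to `p`, no inertia can appear (`span_sub_fixedSubring_eq_top`): if `σ ^ i` acted
trivially on a residue field of `S ^ τ`, some `σ ^ i τ ^ j` would act trivially on a residue field
of `S`, and so would its power `σ ^ (i (p - 1))`, which contradicts that `θ - σ ^ (i (p - 1)) θ` is
a unit. To find `j`, the polynomial `∏ (X - τ ^ j b)` over `S ^ τ` is used, with `b` a polynomial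
over `S` that has sufficiently many elements of `S` as coefficients (`exists_pow_forall_apply_eq`).

Finally `τ` is trivial on `R / η` but moves `ρ` modulo `η ^ 2` when `p ≠ 2`
(`not_formallyUnramified`).
-/

namespace MixedArtinSchreier

/-! ### Galois coordinates -/

open TensorProduct in
/-- If for every `1 ≠ g ∈ G` the differences `b - g b` generate the unit ideal, then Galois
coordinates exist: every `g ≠ 1` is killed by an element of `S ⊗ S` lying over `1`, and the
product of these elements over all `g ≠ 1` is the wanted system of coordinates. -/
theorem exists_coordinates {R S : Type*} [CommRing R] [CommRing S] [Algebra R S]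
    (G : Subgroup (S ≃ₐ[R] S)) [Finite G]
    (h : ∀ g ∈ G, g ≠ 1 → Ideal.span (Set.range fun b : S => b - g b) = ⊤) :
    ∃ (n : ℕ) (x y : Fin n → S),
      (∑ i, x i * y i = 1) ∧ ∀ g ∈ G, g ≠ 1 → ∑ i, x i * g (y i) = 0 := by
  classical
  let μ : (S ≃ₐ[R] S) → (S ⊗[R] S →ₐ[R] S) := fun g =>
    Algebra.TensorProduct.productMap (AlgHom.id R S) (g : S →ₐ[R] S)
  have hμ : ∀ g x y, μ g (x ⊗ₜ y) = x * g y := fun g x y => rfl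
  have key : ∀ g ∈ G, g ≠ 1 → ∃ t, μ 1 t = 1 ∧ μ g t = 0 := by
    intro g hg hg1
    have hsurj : Function.Surjective (μ 1) := fun s => ⟨s ⊗ₜ 1, by simp [hμ]⟩
    have htop : Ideal.map (μ 1) (RingHom.ker (μ g)) = ⊤ := by
      rw [eq_top_iff, ← h g hg hg1, Ideal.span_le]
      rintro _ ⟨b, rfl⟩
      refine (Ideal.mem_map_iff_of_surjective (μ 1) hsurj).2
        ⟨1 ⊗ₜ b - g b ⊗ₜ 1, ?_, ?_⟩
      · rw [RingHom.mem_ker, map_sub, hμ, hμ, map_one, mul_one, one_mul, sub_self]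
      · rw [map_sub, hμ, hμ, map_one, mul_one, one_mul, AlgEquiv.one_apply]
    obtain ⟨t, ht, ht1⟩ := (Ideal.mem_map_iff_of_surjective (μ 1) hsurj).1
      (htop ▸ Submodule.mem_top : (1 : S) ∈ Ideal.map (μ 1) (RingHom.ker (μ g)))
    exact ⟨t, ht1, ht⟩
  choose! t ht1 ht0 using key
  have hfin : (G : Set (S ≃ₐ[R] S)).Finite := Set.toFinite _
  obtain ⟨n, x, y, hxy⟩ := TensorProduct.exists_sum_tmul_eq (∏ g ∈ hfin.toFinset.erase 1, t g)
  have hsum : ∀ g, ∑ i, x i * g (y i) = ∏ g' ∈ hfin.toFinset.erase 1, μ g (t g') := by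
    intro g
    rw [← map_prod, hxy, map_sum]
    rfl
  refine ⟨n, x, y, ?_, ?_⟩
  · refine (hsum 1).trans (Finset.prod_eq_one fun g hg => ?_)
    rw [Finset.mem_erase, Set.Finite.mem_toFinset] at hg
    exact ht1 g hg.2 hg.1
  · intro g hg hg1
    rw [hsum]
    refine Finset.prod_eq_zero (i := g) ?_ (ht0 g hg hg1)
    rw [Finset.mem_erase, Set.Finite.mem_toFinset]
    exact ⟨hg1, hg⟩

theorem finite_zpowers_of_pow_eq_one {G : Type*} [Group G] {σ : G} {p : ℕ} (hp : 0 < p)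
    (hσ : σ ^ p = 1) : Finite (Subgroup.zpowers σ) :=
  (isOfFinOrder_iff_pow_eq_one.2 ⟨p, hp, hσ⟩).finite_zpowers

/-- A cyclic group `⟨σ⟩` of order dividing a prime is a Galois group as soon as the differences
`b - σ ^ i b` generate the unit ideal for all `i` prime to `p`. -/
theorem isGaloisWithGroup_zpowers {R S : Type*} [CommRing R] [CommRing S] [Algebra R S]
    {p : ℕ} (hp : p.Prime) (hinj : Function.Injective (algebraMap R S)) (σ : S ≃ₐ[R] S)
    (hσ : σ ^ p = 1)
    (hspan : ∀ i : ℕ, ¬ p ∣ i → Ideal.span (Set.range fun b : S => b - (σ ^ i) b) = ⊤)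
    (hfix : ∀ b, σ b = b → ∃ a, algebraMap R S a = b) :
    IsGaloisWithGroup R S (Subgroup.zpowers σ) := by
  have hfin := finite_zpowers_of_pow_eq_one hp.pos hσ
  refine ⟨hfin, hinj, fun b hb => hfix b (hb σ (Subgroup.mem_zpowers σ)),
    exists_coordinates _ fun g hg hg1 => ?_⟩
  obtain ⟨i, rfl⟩ := ((isOfFinOrder_iff_pow_eq_one.2
    ⟨p, hp.pos, hσ⟩).mem_powers_iff_mem_zpowers).2 hg
  refine hspan i ?_
  rintro ⟨k, rfl⟩
  exact hg1 (by simp only [pow_mul, hσ, one_pow])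

/-! ### The ring of invariants of a cyclic group -/

section Invariants

variable {B : Type*} [CommRing B]

/-- `∏_{j < m} (X - g ^ j b)`. -/
noncomputable def orbitPoly (g : B ≃+* B) (m : ℕ) (b : B) : B[X] :=
  ∏ j ∈ Finset.range m, (X - C ((g ^ j) b))

theorem orbitPoly_coeff_mem {g : B ≃+* B} {m : ℕ} (hg : g ^ m = 1) (b : B) (n : ℕ) :
    (orbitPoly g m b).coeff n ∈ fixedSubring g := by
  have h : (orbitPoly g m b).map (g : B →+* B) = orbitPoly g m b := by
    unfold orbitPoly
    rw [Polynomial.map_prod]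
    refine Eq.trans (Finset.prod_congr rfl fun j _ => ?_)
      (TauData.prod_shift (fun j => X - C ((g ^ j) b)) m (by simp [hg]))
    simp [pow_succ', RingAut.mul_apply]
  have h' := congrArg (fun q => q.coeff n) h
  simp only [coeff_map] at h'
  exact h'

theorem orbitPoly_monic (g : B ≃+* B) (m : ℕ) (b : B) : (orbitPoly g m b).Monic :=
  monic_prod_of_monic _ _ fun _ _ => monic_X_sub_C _

theorem eval_orbitPoly {g : B ≃+* B} {m : ℕ} (hm : 0 < m) (b : B) :
    (orbitPoly g m b).eval b = 0 := by
  rw [orbitPoly, eval_prod]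
  exact Finset.prod_eq_zero (Finset.mem_range.2 hm) (by simp)

theorem isIntegral_fixedSubring {g : B ≃+* B} {m : ℕ} (hm : 0 < m) (hg : g ^ m = 1) :
    Algebra.IsIntegral (fixedSubring g) B := by
  refine ⟨fun b => ?_⟩
  have hc : (↑(orbitPoly g m b).coeffs : Set B) ⊆ fixedSubring g := by
    intro c hc
    obtain ⟨n, -, rfl⟩ := mem_coeffs_iff.1 hc
    exact orbitPoly_coeff_mem hg b n
  refine ⟨(orbitPoly g m b).toSubring _ hc,
    (monic_toSubring _ _ hc).2 (orbitPoly_monic g m b), ?_⟩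
  have h : ((orbitPoly g m b).toSubring _ hc).map (algebraMap (fixedSubring g) B)
      = orbitPoly g m b := map_toSubring _ _ hc
  rw [← eval_map, h, eval_orbitPoly hm]

/-- Two homomorphisms into a domain that agree on `B ^ g` agree, at any given element, up to
a power of `g`. -/
theorem exists_pow_apply_eq {g : B ≃+* B} {m : ℕ} (hm : 0 < m) (hg : g ^ m = 1)
    {K : Type*} [CommRing K] [IsDomain K] (φ ψ : B →+* K)
    (h : ∀ b, g b = b → φ b = ψ b) (b : B) : ∃ j < m, φ b = ψ ((g ^ j) b) := by
  have h1 : (orbitPoly g m b).map φ = (orbitPoly g m b).map ψ := by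
    ext n
    rw [coeff_map, coeff_map]
    exact h _ (orbitPoly_coeff_mem hg b n)
  have h2 : ((orbitPoly g m b).map φ).eval (φ b) = 0 := by
    rw [eval_map, eval₂_at_apply, eval_orbitPoly hm, map_zero]
  rw [h1, orbitPoly, Polynomial.map_prod, eval_prod, Finset.prod_eq_zero_iff] at h2
  obtain ⟨j, hj, h3⟩ := h2
  refine ⟨j, Finset.mem_range.1 hj, ?_⟩
  simpa [sub_eq_zero] using h3

/-- The power of `g` in `exists_pow_apply_eq` can be chosen uniformly on a finite family: apply
that lemma to the polynomial over `B` whose coefficients are the members of the family. -/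
theorem exists_pow_forall_apply_eq {g : B ≃+* B} {m : ℕ} (hm : 0 < m) (hg : g ^ m = 1)
    {K : Type*} [CommRing K] [IsDomain K] (φ ψ : B →+* K)
    (h : ∀ b, g b = b → φ b = ψ b) (n : ℕ) (a : ℕ → B) :
    ∃ j < m, ∀ k < n, φ (a k) = ψ ((g ^ j) (a k)) := by
  have hcoeff : ∀ (j : ℕ) (q : B[X]) (k : ℕ),
      (((Polynomial.mapEquiv g : B[X] ≃+* B[X]) ^ j) q).coeff k = (g ^ j) (q.coeff k) := by
    intro j
    induction j with
    | zero => intro q k; rfl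
    | succ j ih =>
      intro q k
      rw [pow_succ', pow_succ', RingAut.mul_apply, RingAut.mul_apply, ← ih]
      simp
  obtain ⟨j, hj, hF⟩ := exists_pow_apply_eq (g := (Polynomial.mapEquiv g : B[X] ≃+* B[X])) hm
    (by ext q k; rw [hcoeff, hg]; rfl) (mapRingHom φ) (mapRingHom ψ) (by
      intro q hq
      ext k
      rw [coe_mapRingHom, coe_mapRingHom, coeff_map, coeff_map]
      refine h _ ?_
      have := hcoeff 1 q k
      rw [pow_one, pow_one, hq] at this
      exact this.symm) (∑ k ∈ Finset.range n, monomial k (a k))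
  refine ⟨j, hj, fun k hk => ?_⟩
  have hk' : (∑ k ∈ Finset.range n, monomial k (a k)).coeff k = a k := by
    simp [finsetSum_coeff, coeff_monomial, hk]
  have h' := congrArg (fun q => q.coeff k) hF
  simp only [coe_mapRingHom, coeff_map, hcoeff, hk'] at h'
  exact h'

end Invariants

/-! ### Descent of a cyclic Galois extension along a group of coprime order -/

/-- The differences `b - σ b` of elements of `B ^ g` generate the unit ideal of `B ^ g`, if
`g ^ m = 1` and some difference `θ - σ ^ m θ` is a unit of `B`. Otherwise there is a prime `Q`
of `B` such that `σ` acts trivially on `B ^ g` modulo `Q`; then `h = σ g ^ j` acts trivially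
modulo `Q`, for some `j`, on as many elements as needed, and so does `σ ^ m = h ^ m`. -/
theorem span_sub_fixedSubring_eq_top {B : Type*} [CommRing B] {g σ : B ≃+* B}
    (hcomm : Commute σ g) {m : ℕ} (hm : 0 < m) (hg : g ^ m = 1) {θ : B}
    (hθ : IsUnit (θ - (σ ^ m) θ)) (σ' : fixedSubring g → fixedSubring g)
    (hσ' : ∀ b, (σ' b : B) = σ b) :
    Ideal.span (Set.range fun b : fixedSubring g => b - σ' b) = ⊤ := by
  by_contra hne
  obtain ⟨M, hM, hle⟩ := Ideal.exists_le_maximal _ hne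
  have := isIntegral_fixedSubring hm hg
  obtain ⟨Q, -, hQ, hQM⟩ := Ideal.exists_ideal_over_prime_of_isIntegral M (⊥ : Ideal B) (by
    have h0 : Ideal.comap (algebraMap (fixedSubring g) B) ⊥ = ⊥ :=
      (RingHom.injective_iff_ker_eq_bot _).1 Subtype.val_injective
    rw [h0]; exact bot_le)
  obtain ⟨j, hj, h⟩ := exists_pow_forall_apply_eq hm hg (Ideal.Quotient.mk Q)
    ((Ideal.Quotient.mk Q).comp (σ : B →+* B)) (by
      intro b hb
      have h1 : (⟨b, hb⟩ : fixedSubring g) - σ' ⟨b, hb⟩ ∈ M :=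
        hle (Ideal.subset_span ⟨_, rfl⟩)
      rw [← hQM, Ideal.mem_comap, map_sub] at h1
      refine Ideal.Quotient.eq.2 ?_
      change b - ((σ' ⟨b, hb⟩ : fixedSubring g) : B) ∈ Q at h1
      rwa [hσ'] at h1) (m * m) (fun k => ((σ * g ^ (k / m)) ^ (k % m)) θ)
  have hstep : ∀ n ≤ m, Ideal.Quotient.mk Q θ = Ideal.Quotient.mk Q (((σ * g ^ j) ^ n) θ) := by
    intro n
    induction n with
    | zero => intro _; rfl
    | succ n ih =>
      intro hn
      have h2 := h (n + m * j) (by nlinarith)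
      rw [Nat.add_mul_div_left _ _ hm, Nat.div_eq_of_lt (by omega), Nat.add_mul_mod_self_left,
        Nat.mod_eq_of_lt (by omega), zero_add] at h2
      rw [ih (by omega), h2, pow_succ', RingAut.mul_apply, RingAut.mul_apply]
      rfl
  have h3 := hstep m le_rfl
  rw [(hcomm.pow_right j).mul_pow, ← pow_mul, mul_comm j m, pow_mul, hg, one_pow, mul_one,
    Ideal.Quotient.eq] at h3
  exact hQ.ne_top (Ideal.eq_top_of_isUnit_mem _ h3 hθ)

/-- Let `B/A` be Galois with group `⟨σ⟩` of prime order `p`, and let `g` be an automorphism of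
`B` of order prime to `p` that commutes with `σ` and extends an automorphism `f` of `A`. Then
`B ^ g` is Galois over `A ^ f` with group generated by the restriction of `σ`, no matter how
`A` ramifies over `A ^ f`. -/
theorem exists_isGaloisWithGroup_fixedSubring {A B : Type*} [CommRing A] [CommRing B]
    [Algebra A B] [Nontrivial B] (hinj : Function.Injective (algebraMap A B)) (f : A ≃+* A)
    (g : B ≃+* B) (h : ∀ a : A, g (algebraMap A B a) = algebraMap A B (f a))
    {p : ℕ} (hp : p.Prime) (σ : B ≃ₐ[A] B) (hσ : σ ^ p = 1) {θ : B}
    (hθ : ∀ i : ℕ, ¬ p ∣ i → IsUnit (θ - (σ ^ i) θ))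
    (hfix : ∀ b, σ b = b → ∃ a, algebraMap A B a = b)
    {m : ℕ} (hm : 0 < m) (hpm : ¬ p ∣ m) (hg : g ^ m = 1)
    (hcomm : ∀ b, g (σ b) = σ (g b)) :
    letI := fixedAlgebra f g h
    ∃ σ' : fixedSubring g ≃ₐ[fixedSubring f] fixedSubring g,
      (∀ a : fixedSubring g, ((σ' a : fixedSubring g) : B) = σ (a : B)) ∧
      Nat.card (Subgroup.zpowers σ') = p ∧
      IsGaloisWithGroup (fixedSubring f) (fixedSubring g) (Subgroup.zpowers σ') := by
  let := fixedAlgebra f g h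
  have halg : ∀ a : fixedSubring f, ((algebraMap (fixedSubring f) (fixedSubring g) a :
      fixedSubring g) : B) = algebraMap A B a := fun a => rfl
  have hsymm : ∀ b, g (σ.symm b) = σ.symm (g b) := fun b => by
    rw [AlgEquiv.eq_symm_apply, ← hcomm, AlgEquiv.apply_symm_apply]
  let σ' : fixedSubring g ≃ₐ[fixedSubring f] fixedSubring g :=
    { toFun := fun b => ⟨σ b, (hcomm b).trans (congrArg σ b.2)⟩
      invFun := fun b => ⟨σ.symm b, (hsymm b).trans (congrArg σ.symm b.2)⟩
      left_inv := fun b => Subtype.ext (σ.symm_apply_apply b)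
      right_inv := fun b => Subtype.ext (σ.apply_symm_apply b)
      map_mul' := fun a b => Subtype.ext (map_mul σ _ _)
      map_add' := fun a b => Subtype.ext (map_add σ _ _)
      commutes' := fun a => Subtype.ext (σ.commutes a) }
  have hσ' : ∀ b : fixedSubring g, ((σ' b : fixedSubring g) : B) = σ (b : B) := fun b => rfl
  have hpow : ∀ (i : ℕ) (b : fixedSubring g),
      (((σ' ^ i) b : fixedSubring g) : B) = (σ ^ i) (b : B) := by
    intro i
    induction i with
    | zero => intro b; rfl
    | succ i ih =>
      intro b
      rw [pow_succ', pow_succ', AlgEquiv.mul_apply, AlgEquiv.mul_apply, hσ', ih]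
  have hσ'p : σ' ^ p = 1 := by
    ext b
    rw [hpow, hσ]; rfl
  have hpowR : ∀ (i : ℕ) (b : B), ((σ : B ≃+* B) ^ i) b = (σ ^ i) b := by
    intro i
    induction i with
    | zero => intro b; rfl
    | succ i ih =>
      intro b
      rw [pow_succ', pow_succ', RingAut.mul_apply, AlgEquiv.mul_apply, ih]; rfl
  have hspan : ∀ i : ℕ, ¬ p ∣ i →
      Ideal.span (Set.range fun b : fixedSubring g => b - (σ' ^ i) b) = ⊤ := by
    intro i hi
    have hc : Commute (σ : B ≃+* B) g := by
      refine RingEquiv.ext fun b => ?_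
      exact (hcomm b).symm
    refine span_sub_fixedSubring_eq_top (σ := (σ : B ≃+* B) ^ i) (hc.pow_left i) hm hg
      (θ := θ) ?_ _ (fun b => ?_)
    · rw [← pow_mul, hpowR]
      exact hθ _ fun hd => (hp.dvd_mul.1 hd).elim hi hpm
    · rw [hpow, hpowR]
  refine ⟨σ', hσ', ?_, ?_⟩
  · rw [Nat.card_zpowers]
    refine (hp.eq_one_or_self_of_dvd _ (orderOf_dvd_of_pow_eq_one hσ'p)).resolve_left ?_
    intro h1
    have h2 := hspan 1 (Nat.Prime.not_dvd_one hp)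
    rw [orderOf_eq_one_iff] at h1
    rw [h1, one_pow] at h2
    simp only [AlgEquiv.one_apply, sub_self] at h2
    have h3 : Ideal.span (Set.range fun _ : fixedSubring g => (0 : fixedSubring g)) = ⊥ := by
      simp
    exact bot_ne_top (h3.symm.trans h2)
  · refine isGaloisWithGroup_zpowers hp ?_ σ' hσ'p hspan ?_
    · intro a b hab
      refine Subtype.ext (hinj ?_)
      rw [← halg, ← halg, hab]
    · intro b hb
      obtain ⟨a, ha⟩ := hfix b (by rw [← hσ', hb])
      refine ⟨⟨a, hinj ?_⟩, Subtype.ext ha⟩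
      rw [← h, ha]
      exact b.2

/-! ### The equation `Z ^ p + g(Z) = u` as a Kummer equation -/

theorem mul_binomQuot {p i : ℕ} (hp : p.Prime) (hi : i ∈ Finset.Icc 1 (p - 1)) :
    p * binomQuot p i = p.choose i := by
  rw [Finset.mem_Icc] at hi
  exact Nat.mul_div_cancel' (hp.dvd_choose_self (by omega) (by have := hp.pos; omega))

/-- Multiplied by `η ^ p`, the polynomial `t ^ p + g(t)` becomes `(1 + t η) ^ p - 1`. -/
theorem one_add_mul_eta_pow (p : ℕ) [hp : Fact p.Prime] {B : Type*} [CommRing B]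
    (ψ : CycInt p →+* B) (t : B) :
    (1 + t * ψ (eta p)) ^ p = 1 + (t ^ p + (gPoly p).eval₂ ψ t) * ψ (eta p) ^ p := by
  have hp1 : p - 1 + 1 = p := Nat.sub_add_cancel hp.out.one_lt.le
  have hpx : (p : B) = ψ (xElt p) * ψ (eta p) ^ (p - 1) := by
    rw [← map_pow, ← map_mul, ← (isUnit_yElt_and_eq p).2, map_natCast]
  have hmid : ∑ m ∈ Finset.range (p - 1), (t * ψ (eta p)) ^ (m + 1) * (p.choose (m + 1) : B)
      = (gPoly p).eval₂ ψ t * ψ (eta p) ^ p := by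
    rw [gPoly, eval₂_mul, eval₂_C, eval₂_finsetSum, Finset.mul_sum, Finset.sum_mul,
      Finset.range_eq_Ico, Finset.sum_Ico_add' (fun m => (t * ψ (eta p)) ^ m * (p.choose m : B))
        0 (p - 1) 1]
    refine Finset.sum_congr (by ext; simp) ?_
    intro i hi
    rw [← mul_binomQuot hp.out hi, eval₂_mul, eval₂_C, eval₂_X_pow, map_mul, map_natCast, map_pow,
      Nat.cast_mul, hpx]
    obtain ⟨j, rfl⟩ : ∃ j, i = j + 1 := ⟨i - 1, by rw [Finset.mem_Icc] at hi; omega⟩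
    have h : ψ (eta p) ^ p = ψ (eta p) ^ (p - 1) * ψ (eta p) := by rw [← pow_succ, hp1]
    rw [h, Nat.add_sub_cancel]
    ring
  rw [add_comm, add_pow]
  simp only [one_pow, mul_one]
  have h3 := Finset.sum_range_succ' (fun m => (t * ψ (eta p)) ^ m * (p.choose m : B)) (p - 1)
  simp only [hp1] at h3
  rw [Finset.sum_range_succ, h3, hmid]
  simp only [pow_zero, Nat.choose_self, Nat.choose_zero_right, Nat.cast_one, mul_one]
  rw [mul_pow]
  ring

theorem degree_gPoly_lt (p : ℕ) [hp : Fact p.Prime] : (gPoly p).degree < p := by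
  rw [gPoly, Finset.mul_sum]
  refine lt_of_le_of_lt (degree_sum_le _ _) ((Finset.sup_lt_iff (WithBot.bot_lt_coe p)).2 ?_)
  intro i hi
  rw [← mul_assoc, ← C_mul]
  rw [Finset.mem_Icc] at hi
  refine (degree_C_mul_X_pow_le _ _).trans_lt ?_
  have := hp.out.pos
  exact Nat.cast_lt.2 (by omega)

theorem one_add_oplusSum {A : Type*} [CommRing A] (e : A) (f : ℕ → A) (n : ℕ) :
    1 + oplusSum e f n * e = ∏ i ∈ Finset.range n, (1 + f i * e) := by
  induction n with
  | zero => simp [oplusSum]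
  | succ n ih => rw [oplusSum, one_add_oplus, ih, Finset.prod_range_succ]

/-! ### Arithmetic of `ℤ[ρ]` -/

theorem eta_ne_zero (p : ℕ) [hp : Fact p.Prime] : eta p ≠ 0 :=
  (rho_isPrimitiveRoot p).sub_one_ne_zero hp.out.one_lt

theorem rho_pow_sub_one (p n : ℕ) :
    rho p ^ n - 1 = (∑ i ∈ Finset.range n, rho p ^ i) * eta p := by
  rw [eta, geom_sum_mul]

theorem isUnit_geom_sum_rho {p n : ℕ} [hp : Fact p.Prime] (h : ¬ p ∣ n) :
    IsUnit (∑ i ∈ Finset.range n, rho p ^ i) :=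
  (rho_isPrimitiveRoot p).geom_sum_isUnit hp.out.two_le
    (Nat.coprime_comm.1 ((hp.out.coprime_iff_not_dvd).2 h))

theorem not_isUnit_eta (p : ℕ) [hp : Fact p.Prime] : ¬ IsUnit (eta p) := by
  intro h
  have h1 : (cyclotomic p ℤ).eval₂ (Int.castRingHom (ZMod p)) 1 = 0 := by
    rw [← eval_map, map_cyclotomic_int, eval_one_cyclotomic_prime, CharP.cast_eq_zero]
  have h2 := h.map (AdjoinRoot.lift (Int.castRingHom (ZMod p)) 1 h1)
  rw [eta, rho, map_sub, AdjoinRoot.lift_root, map_one, sub_self] at h2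
  exact not_isUnit_zero h2

/-- Complex conjugation `ρ ↦ ρ⁻¹ = ρ ^ (p - 1)`. -/
theorem exists_conj (p : ℕ) [hp : Fact p.Prime] :
    ∃ c : CycInt p ≃+* CycInt p, c (rho p) = rho p ^ (p - 1) := by
  have hprim : IsPrimitiveRoot (rho p ^ (p - 1)) p := by
    refine (rho_isPrimitiveRoot p).pow_of_coprime _ ?_
    have := (Nat.coprime_self_sub_right hp.out.one_lt.le : p.Coprime (p - 1) ↔ _)
    exact Nat.coprime_comm.1 (this.2 (Nat.coprime_one_right p))
  have h0 : (cyclotomic p ℤ).eval₂ (Int.castRingHom (CycInt p)) (rho p ^ (p - 1)) = 0 := by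
    rw [← eval_map, map_cyclotomic_int]
    exact hprim.isRoot_cyclotomic hp.out.pos
  let c := AdjoinRoot.lift (Int.castRingHom (CycInt p)) (rho p ^ (p - 1)) h0
  have hc : c (rho p) = rho p ^ (p - 1) := AdjoinRoot.lift_root h0
  have hcc : c.comp c = RingHom.id _ := by
    refine AdjoinRoot.ringHom_ext (RingHom.ext_int _ _) ?_
    change c (c (rho p)) = rho p
    have hsq : (p - 1) * (p - 1) = p * (p - 2) + 1 := by
      obtain ⟨k, hk⟩ : ∃ k, p = k + 2 := ⟨p - 2, by have := hp.out.two_le; omega⟩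
      rw [hk, Nat.add_sub_cancel, show k + 2 - 1 = k + 1 by omega]
      ring
    rw [hc, map_pow, hc, ← pow_mul, hsq, pow_succ, pow_mul, rho_pow, one_pow, one_mul]
  exact ⟨RingEquiv.ofRingHom c c hcc hcc, hc⟩

namespace TauData

variable {p : ℕ} [hp : Fact p.Prime] (D : TauData p)

omit hp in
theorem τ_eta : D.τ (eta p) = D.delta * eta p := by
  rw [delta, ← rho_pow_sub_one, eta, map_sub, D.τ_rho, map_one]

theorem s_pos : 0 < D.s := by
  refine Nat.pos_of_ne_zero fun h => ?_
  have h1 := D.s_pow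
  rw [h, zero_pow (Nat.sub_pos_of_lt hp.out.one_lt).ne'] at h1
  omega

/-- For odd `p` the generator `τ` is not trivial, since complex conjugation is not. -/
theorem not_dvd_s_sub_one (h2 : p ≠ 2) : ¬ p ∣ D.s - 1 := by
  rintro ⟨k, hk⟩
  have hs : D.s = p * k + 1 := by have := D.s_pos; omega
  have hτρ : D.τ (rho p) = rho p := by
    rw [D.τ_rho, hs, pow_succ, pow_mul, rho_pow, one_pow, one_mul]
  have hτ : D.τ = 1 := by
    have h : (D.τ : CycInt p →+* CycInt p) = RingHom.id (CycInt p) :=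
      AdjoinRoot.ringHom_ext (RingHom.ext_int _ _) hτρ
    exact RingEquiv.ext fun a => RingHom.congr_fun h a
  obtain ⟨c, hc⟩ := exists_conj p
  have h1 := D.generates c
  rw [hτ, Subgroup.zpowers_one_eq_bot, Subgroup.mem_bot] at h1
  rw [h1, RingAut.one_apply] at hc
  have h3 := (rho_isPrimitiveRoot p).pow_inj hp.out.one_lt (Nat.sub_lt hp.out.pos one_pos)
    ((pow_one _).trans hc)
  omega

/-! ### The ring `R` -/

omit hp in
theorem constantCoeff_τPoly_pow (k : ℕ) (a : MvPolynomial (Fin (p - 1)) (CycInt p)) :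
    MvPolynomial.constantCoeff ((D.τPoly ^ k) a) = (D.τ ^ k) (MvPolynomial.constantCoeff a) := by
  induction k with
  | zero => rfl
  | succ k ih =>
    rw [pow_succ', pow_succ', RingAut.mul_apply, RingAut.mul_apply, ← ih]
    exact MvPolynomial.constantCoeff_map _ _

omit hp in
theorem constantCoeff_normC : MvPolynomial.constantCoeff D.normC = 1 := by
  rw [normC, map_prod]
  refine Finset.prod_eq_one fun i _ => ?_
  rw [constantCoeff_τPoly_pow]
  simp [zPoly]

instance : IsDomain D.BaseRing := by
  refine IsLocalization.isDomain_localization (powers_le_nonZeroDivisors_of_noZeroDivisors ?_)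
  intro h
  have h1 := D.constantCoeff_normC
  rw [h, map_zero] at h1
  exact zero_ne_one h1

/-- The retraction `R → ℤ[ρ]` with `xᵢ ↦ 0`. -/
noncomputable def augmentation : D.BaseRing →+* CycInt p :=
  IsLocalization.Away.lift (S := D.BaseRing) D.normC
    (g := (MvPolynomial.constantCoeff : MvPolynomial (Fin (p - 1)) (CycInt p) →+* CycInt p))
    (by rw [constantCoeff_normC]; exact isUnit_one)

omit hp in
theorem algebraMap_baseRing (a : CycInt p) : algebraMap (CycInt p) D.BaseRing a =
    algebraMap (MvPolynomial (Fin (p - 1)) (CycInt p)) D.BaseRing (MvPolynomial.C a) :=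
  IsScalarTower.algebraMap_apply (CycInt p) (MvPolynomial (Fin (p - 1)) (CycInt p)) D.BaseRing a

omit hp in
theorem augmentation_algebraMap (a : CycInt p) :
    D.augmentation (algebraMap (CycInt p) D.BaseRing a) = a := by
  rw [algebraMap_baseRing]
  exact (IsLocalization.Away.lift_eq D.normC _ _).trans (MvPolynomial.constantCoeff_C _ a)

theorem not_isUnit_etaR : ¬ IsUnit D.etaR := fun h => not_isUnit_eta p (by
  have := h.map D.augmentation
  rwa [etaR, augmentation_algebraMap] at this)

theorem etaR_ne_zero : D.etaR ≠ 0 := fun h => eta_ne_zero p (by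
  have := congrArg D.augmentation h
  rwa [etaR, augmentation_algebraMap, map_zero] at this)

theorem τR_algebraMap_poly (a : MvPolynomial (Fin (p - 1)) (CycInt p)) :
    D.τR (algebraMap _ D.BaseRing a) = algebraMap _ D.BaseRing (D.τPoly a) :=
  IsLocalization.ringEquivOfRingEquiv_eq _ _

theorem τR_algebraMap (a : CycInt p) :
    D.τR (algebraMap (CycInt p) D.BaseRing a) = algebraMap (CycInt p) D.BaseRing (D.τ a) := by
  rw [algebraMap_baseRing, algebraMap_baseRing, τR_algebraMap_poly]
  congr 1
  exact MvPolynomial.map_C _ a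

theorem τR_etaR : D.τR D.etaR = D.deltaR * D.etaR := by
  rw [etaR, τR_algebraMap, τ_eta, map_mul, deltaR]

theorem τR_pow : D.τR ^ (p - 1) = 1 := by
  have h : ∀ (k : ℕ) a, (D.τR ^ k) (algebraMap _ D.BaseRing a)
      = algebraMap _ D.BaseRing ((D.τPoly ^ k) a) := by
    intro k
    induction k with
    | zero => intro a; rfl
    | succ k ih =>
      intro a
      rw [pow_succ', pow_succ', RingAut.mul_apply, RingAut.mul_apply, ih, τR_algebraMap_poly]
  have h1 : ((D.τR ^ (p - 1) : D.BaseRing ≃+* D.BaseRing) : D.BaseRing →+* D.BaseRing)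
      = RingHom.id _ := by
    refine IsLocalization.ringHom_ext (Submonoid.powers D.normC) (RingHom.ext fun a => ?_)
    refine (h (p - 1) a).trans ?_
    rw [D.τPoly_pow]
    rfl
  exact RingEquiv.ext fun a => RingHom.congr_fun h1 a

/-- The automorphism `τ` of `R` is nontrivial for odd `p`, but trivial modulo the prime `η`,
so that `τ` and the identity are two `R ^ τ`-homomorphisms `R → R / η ^ 2` which agree modulo
the nilpotent ideal `(η)` and differ at `ρ`. -/
theorem not_formallyUnramified (h2 : p ≠ 2) :
    ¬ Algebra.FormallyUnramified (fixedSubring D.τR) D.BaseRing := by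
  intro hunr
  have hmod : ∀ x : D.BaseRing, x - D.τR x ∈ Ideal.span {D.etaR} := by
    have h : Ideal.Quotient.mk (Ideal.span {D.etaR})
        = (Ideal.Quotient.mk (Ideal.span {D.etaR})).comp (D.τR : D.BaseRing →+* D.BaseRing) := by
      refine IsLocalization.ringHom_ext (Submonoid.powers D.normC)
        (MvPolynomial.ringHom_ext' (AdjoinRoot.ringHom_ext (RingHom.ext_int _ _) ?_) fun i => ?_)
      · change Ideal.Quotient.mk _ (algebraMap _ D.BaseRing (MvPolynomial.C (rho p)))
          = Ideal.Quotient.mk _ (D.τR (algebraMap _ D.BaseRing (MvPolynomial.C (rho p))))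
        rw [← algebraMap_baseRing, τR_algebraMap, D.τ_rho, Ideal.Quotient.eq,
          Ideal.mem_span_singleton, ← map_sub, etaR]
        refine map_dvd _ ?_
        have : rho p - rho p ^ D.s = (rho p - 1) - (rho p ^ D.s - 1) := by ring
        rw [this, rho_pow_sub_one]
        exact dvd_sub dvd_rfl (dvd_mul_left _ _)
      · change Ideal.Quotient.mk _ (algebraMap _ D.BaseRing (MvPolynomial.X i))
          = Ideal.Quotient.mk _ (D.τR (algebraMap _ D.BaseRing (MvPolynomial.X i)))
        rw [τR_algebraMap_poly]
        congr 2
        exact (MvPolynomial.map_X _ i).symm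
    exact fun x => Ideal.Quotient.eq.1 (RingHom.congr_fun h x)
  let I : Ideal D.BaseRing := Ideal.span {D.etaR ^ 2}
  let τA : D.BaseRing →ₐ[fixedSubring D.τR] D.BaseRing :=
    { (D.τR : D.BaseRing →+* D.BaseRing) with commutes' := fun a => a.2 }
  have heq : Ideal.Quotient.mkₐ (fixedSubring D.τR) I
      = (Ideal.Quotient.mkₐ (fixedSubring D.τR) I).comp τA := by
    refine Algebra.FormallyUnramified.ext (Ideal.span {Ideal.Quotient.mk I D.etaR}) ⟨2, ?_⟩ ?_
    · rw [Ideal.span_singleton_pow, ← map_pow, Ideal.Quotient.eq_zero_iff_mem.2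
        (Ideal.mem_span_singleton_self _), Ideal.zero_eq_bot, Ideal.span_singleton_eq_bot]
    · intro x
      refine Ideal.Quotient.eq.2 ?_
      change Ideal.Quotient.mk I x - Ideal.Quotient.mk I (D.τR x) ∈ _
      rw [← map_sub, Ideal.mem_span_singleton]
      exact map_dvd _ (Ideal.mem_span_singleton.1 (hmod x))
  have hρ := AlgHom.congr_fun heq (algebraMap (CycInt p) D.BaseRing (rho p))
  change Ideal.Quotient.mk I _ = Ideal.Quotient.mk I (D.τR _) at hρ
  rw [Ideal.Quotient.eq, Ideal.mem_span_singleton, τR_algebraMap, D.τ_rho, ← map_sub] at hρ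
  -- `ρ - ρ ^ s = -ρ (ρ ^ (s - 1) - 1)` is a unit times `η`, as `p` does not divide `s - 1`;
  -- divisibility by `η ^ 2` would make `η` a unit.
  have hunit : rho p - rho p ^ D.s
      = -(rho p * ∑ i ∈ Finset.range (D.s - 1), rho p ^ i) * eta p := by
    rw [neg_mul, mul_assoc, ← rho_pow_sub_one, mul_sub, ← pow_succ', Nat.sub_add_cancel D.s_pos]
    ring
  have hu : IsUnit (-(rho p * ∑ i ∈ Finset.range (D.s - 1), rho p ^ i)) :=
    (((rho_isPrimitiveRoot p).isUnit hp.out.ne_zero).mul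
      (isUnit_geom_sum_rho (D.not_dvd_s_sub_one h2))).neg
  rw [hunit, map_mul] at hρ
  have h4 : D.etaR * D.etaR ∣ D.etaR * 1 := by
    rw [mul_one, ← pow_two]
    exact ((hu.map (algebraMap (CycInt p) D.BaseRing)).dvd_mul_left).1 hρ
  exact D.not_isUnit_etaR (isUnit_of_dvd_one ((mul_dvd_mul_iff_left D.etaR_ne_zero).1 h4))

/-! ### The norm of `z` -/

/-- The unit `1 + z η ^ p` of `R`. -/
noncomputable def kummerC : D.BaseRing := 1 + D.z * D.etaR ^ p

/-- `∏_{i < k} τ ^ i (1 + z η ^ p) ^ (s ^ (k - 1 - i))`, defined by recursion on `k`. The last one,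
for `k = p - 1`, is `1 + N(z) η ^ p`; the others are the denominators of `τ ^ k (1 + θ η)`. -/
noncomputable def partialNorm : ℕ → D.BaseRing
  | 0 => 1
  | k + 1 => partialNorm k ^ D.s * (D.τR ^ k) D.kummerC

theorem partialNorm_succ (k : ℕ) :
    D.partialNorm (k + 1) = D.partialNorm k ^ D.s * (D.τR ^ k) D.kummerC := rfl

theorem τR_partialNorm_mul (k : ℕ) :
    D.τR (D.partialNorm k) * D.kummerC ^ D.s ^ k = D.partialNorm (k + 1) := by
  induction k with
  | zero => simp [partialNorm]
  | succ k ih =>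
    rw [D.partialNorm_succ (k + 1)]
    nth_rewrite 2 [← ih]
    rw [partialNorm_succ, map_mul, map_pow, pow_succ' D.τR k, RingAut.mul_apply]
    ring

theorem isUnit_partialNorm (k : ℕ) : IsUnit (D.partialNorm k) := by
  induction k with
  | zero => exact isUnit_one
  | succ k ih => exact (ih.pow _).mul (D.isUnit_one_add_z.map (D.τR ^ k))

theorem partialNorm_eq_prod (k : ℕ) : D.partialNorm k =
    ∏ i ∈ Finset.range k, (D.τR ^ i) D.kummerC ^ D.s ^ (k - 1 - i) := by
  induction k with
  | zero => rfl
  | succ k ih =>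
    rw [partialNorm, Finset.prod_range_succ, ih, ← Finset.prod_pow]
    congr 1
    · refine Finset.prod_congr rfl fun i hi => ?_
      rw [← pow_mul, ← pow_succ]
      congr 2
      rw [Finset.mem_range] at hi
      omega
    · simp

theorem one_add_iterate_mul (x : D.BaseRing) (i : ℕ) :
    1 + (fun a => D.deltaR ^ p * D.τR a)^[i] x * D.etaR ^ p
      = (D.τR ^ i) (1 + x * D.etaR ^ p) := by
  induction i with
  | zero => rfl
  | succ i ih =>
    rw [Function.iterate_succ_apply', pow_succ', RingAut.mul_apply, ← ih, map_add, map_mul,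
      map_pow, τR_etaR, map_one]
    ring

/-- `1 + N(z) η ^ p = ∏ τ ^ i (1 + z η ^ p) ^ (s ^ (p - 2 - i))`. -/
theorem one_add_N_mul : 1 + D.N D.z * D.etaR ^ p = D.partialNorm (p - 1) := by
  rw [N, one_add_oplusSum, partialNorm_eq_prod]
  refine Finset.prod_congr rfl fun i _ => ?_
  rw [one_add_starOp, one_add_iterate_mul]
  rfl

/-- `U ^ s = τ(U) (1 + z η ^ p) ^ (p r)` for `U = 1 + N(z) η ^ p`. -/
theorem partialNorm_pow_s : D.partialNorm (p - 1) ^ D.s =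
    D.τR (D.partialNorm (p - 1)) * D.kummerC ^ (p * D.r) := by
  have h := D.τR_partialNorm_mul (p - 1)
  rw [partialNorm, D.τR_pow, RingAut.one_apply, D.s_pow, pow_add, pow_one] at h
  have hu : IsUnit D.kummerC := D.isUnit_one_add_z
  refine hu.mul_right_cancel ?_
  rw [← h]
  ring

/-! ### The automorphisms `σ` and `τ` of `S` -/

theorem degree_gPoly_map_sub_lt :
    ((gPoly p).map (algebraMap (CycInt p) D.BaseRing) - C (D.N D.z)).degree < p := by
  refine lt_of_le_of_lt (degree_sub_le _ _) (max_lt ?_ ?_)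
  · exact degree_map_le.trans_lt (degree_gPoly_lt p)
  · exact degree_C_le.trans_lt (by exact_mod_cast hp.out.pos)

theorem poly_monic : D.poly.Monic := by
  rw [poly, add_sub_assoc]
  exact monic_X_pow_add D.degree_gPoly_map_sub_lt

theorem poly_natDegree : D.poly.natDegree = p := by
  rw [poly, add_sub_assoc]
  refine natDegree_eq_of_degree_eq_some ?_
  rw [degree_add_eq_left_of_degree_lt] <;> rw [degree_X_pow]
  exact D.degree_gPoly_map_sub_lt

/-- Multiplied by `η ^ p`, the value of `Z ^ p + g(Z) - u` at `t` is `(1 + t η) ^ p - U`, with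
`U = 1 + u η ^ p`. -/
theorem eval₂_poly_mul {B : Type*} [CommRing B] (φ : D.BaseRing →+* B) (t : B) :
    D.poly.eval₂ φ t * φ D.etaR ^ p = (1 + t * φ D.etaR) ^ p - φ (D.partialNorm (p - 1)) := by
  have h := one_add_mul_eta_pow p (φ.comp (algebraMap (CycInt p) D.BaseRing)) t
  have he : (φ.comp (algebraMap (CycInt p) D.BaseRing)) (eta p) = φ D.etaR := rfl
  rw [he] at h
  rw [h, ← one_add_N_mul, poly, eval₂_sub, eval₂_add, eval₂_X_pow, eval₂_C, eval₂_map]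
  simp only [map_add, map_mul, map_pow, map_one]
  ring

instance : Module.Free D.BaseRing D.ExtRing := D.poly_monic.free_adjoinRoot

instance : Nontrivial D.ExtRing := AdjoinRoot.nontrivial _ (by
  rw [degree_eq_natDegree D.poly_monic.ne_zero, poly_natDegree]
  exact_mod_cast hp.out.ne_zero)

theorem algebraMap_extRing_injective :
    Function.Injective (algebraMap D.BaseRing D.ExtRing) :=
  FaithfulSMul.algebraMap_injective _ _

theorem mul_algebraMap_cancel {a : D.BaseRing} (ha : a ≠ 0) {x y : D.ExtRing}
    (h : x * algebraMap _ _ a = y * algebraMap _ _ a) : x = y := by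
  refine smul_right_injective D.ExtRing ha ?_
  simpa only [Algebra.smul_def, mul_comm] using h

/-- `η` in `S`. -/
noncomputable def etaS : D.ExtRing := algebraMap D.BaseRing D.ExtRing D.etaR

/-- `ρ` in `S`. -/
noncomputable def rhoS : D.ExtRing := algebraMap (CycInt p) D.ExtRing (rho p)

/-- The Kummer generator `ω = 1 + θ η`. It is a unit with `ω ^ p = 1 + u η ^ p`, and the Galois
action is multiplicative in terms of it: `σ(ω) = ρ ω` and `τ(ω) = ω ^ s / (1 + z η ^ p) ^ r`. -/
noncomputable def omega : D.ExtRing := 1 + D.theta * D.etaS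

theorem mul_etaS_cancel {x y : D.ExtRing} (h : x * D.etaS = y * D.etaS) : x = y :=
  D.mul_algebraMap_cancel D.etaR_ne_zero h

theorem algebraMap_extRing (a : CycInt p) : algebraMap (CycInt p) D.ExtRing a =
    algebraMap D.BaseRing D.ExtRing (algebraMap (CycInt p) D.BaseRing a) :=
  IsScalarTower.algebraMap_apply _ _ _ a

theorem etaS_eq : D.etaS = D.rhoS - 1 := by
  rw [etaS, etaR, ← algebraMap_extRing, eta, map_sub, map_one, rhoS]

theorem rhoS_pow : D.rhoS ^ p = 1 := by
  rw [rhoS, ← map_pow, rho_pow, map_one]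

theorem omega_pow : D.omega ^ p = algebraMap D.BaseRing D.ExtRing (D.partialNorm (p - 1)) := by
  have h := D.eval₂_poly_mul (algebraMap D.BaseRing D.ExtRing) D.theta
  have h0 : D.poly.eval₂ (algebraMap D.BaseRing D.ExtRing) D.theta = 0 :=
    AdjoinRoot.eval₂_root D.poly
  rw [h0, zero_mul] at h
  exact (sub_eq_zero.1 h.symm)

theorem isUnit_omega : IsUnit D.omega := by
  rw [← isUnit_pow_iff hp.out.ne_zero, omega_pow]
  exact (D.isUnit_partialNorm _).map _

theorem one_add_sigma_theta : 1 + (D.rhoS * D.theta + 1) * D.etaS = D.rhoS * D.omega := by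
  rw [omega, etaS_eq]
  ring

theorem eval₂_sigma_theta :
    D.poly.eval₂ (algebraMap D.BaseRing D.ExtRing) (D.rhoS * D.theta + 1) = 0 := by
  have h := D.eval₂_poly_mul (algebraMap D.BaseRing D.ExtRing) (D.rhoS * D.theta + 1)
  change _ = (1 + (D.rhoS * D.theta + 1) * D.etaS) ^ p - _ at h
  rw [one_add_sigma_theta, mul_pow, rhoS_pow, one_mul, omega_pow, sub_self, ← map_pow] at h
  exact D.mul_algebraMap_cancel (pow_ne_zero p D.etaR_ne_zero) (by rw [h, zero_mul])

/-- `σ`, as a homomorphism: `σ(θ) = ρ θ + 1`. -/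
noncomputable def sigmaHom : D.ExtRing →ₐ[D.BaseRing] D.ExtRing :=
  AdjoinRoot.liftAlgHom D.poly (Algebra.ofId D.BaseRing D.ExtRing) (D.rhoS * D.theta + 1)
    D.eval₂_sigma_theta

theorem sigmaHom_theta : D.sigmaHom D.theta = D.rhoS * D.theta + 1 :=
  AdjoinRoot.liftAlgHom_root _ _ _ _

theorem algHom_etaS (f : D.ExtRing →ₐ[D.BaseRing] D.ExtRing) : f D.etaS = D.etaS :=
  f.commutes _

theorem algHom_rhoS (f : D.ExtRing →ₐ[D.BaseRing] D.ExtRing) : f D.rhoS = D.rhoS := by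
  rw [rhoS, algebraMap_extRing, f.commutes]

theorem sigmaHom_omega : D.sigmaHom D.omega = D.rhoS * D.omega := by
  rw [← one_add_sigma_theta, omega, map_add, map_mul, map_one, algHom_etaS, sigmaHom_theta]

theorem sigmaHom_pow_omega (k : ℕ) : (D.sigmaHom ^ k) D.omega = D.rhoS ^ k * D.omega := by
  induction k with
  | zero => simp
  | succ k ih =>
    rw [pow_succ', AlgHom.mul_apply, ih, map_mul, map_pow, algHom_rhoS, sigmaHom_omega,
      pow_succ, mul_assoc]

/-- As `η` is regular, equations between images of `ω` descend to images of `θ`. -/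
theorem theta_eq_of_omega_eq (f : D.ExtRing →ₐ[D.BaseRing] D.ExtRing)
    (h : f D.omega = D.omega) : f D.theta = D.theta := by
  rw [omega, map_add, map_mul, map_one, algHom_etaS] at h
  exact D.mul_etaS_cancel (add_left_cancel h)

theorem sigmaHom_pow : D.sigmaHom ^ p = 1 := by
  refine AdjoinRoot.algHom_ext (D.theta_eq_of_omega_eq _ ?_)
  rw [sigmaHom_pow_omega, rhoS_pow, one_mul]

/-- The `R`-automorphism `σ` of `S`. -/
noncomputable def sigma : D.ExtRing ≃ₐ[D.BaseRing] D.ExtRing :=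
  AlgEquiv.ofAlgHom D.sigmaHom (D.sigmaHom ^ (p - 1))
    ((pow_succ' D.sigmaHom (p - 1)).symm.trans (by
      rw [Nat.sub_add_cancel hp.out.one_lt.le, sigmaHom_pow]; rfl))
    ((pow_succ D.sigmaHom (p - 1)).symm.trans (by
      rw [Nat.sub_add_cancel hp.out.one_lt.le, sigmaHom_pow]; rfl))

theorem sigma_theta : D.sigma D.theta = D.rhoS * D.theta + 1 := D.sigmaHom_theta

theorem sigma_pow_apply (k : ℕ) (b : D.ExtRing) : (D.sigma ^ k) b = (D.sigmaHom ^ k) b := by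
  induction k generalizing b with
  | zero => rfl
  | succ k ih => rw [pow_succ, pow_succ, AlgEquiv.mul_apply, AlgHom.mul_apply, ih]; rfl

theorem sigma_pow : D.sigma ^ p = 1 := by
  ext b
  rw [sigma_pow_apply, sigmaHom_pow]
  rfl

/-- `θ - σ ^ i θ = - (1 + ρ + ⋯ + ρ ^ (i - 1)) ω`. -/
theorem theta_sub_sigma_pow_theta (i : ℕ) : D.theta - (D.sigma ^ i) D.theta =
    -(algebraMap (CycInt p) D.ExtRing (∑ j ∈ Finset.range i, rho p ^ j) * D.omega) := by
  refine D.mul_etaS_cancel ?_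
  have h1 := D.sigmaHom_pow_omega i
  rw [← sigma_pow_apply] at h1
  have h2 : D.omega - (D.sigma ^ i) D.omega = (D.theta - (D.sigma ^ i) D.theta) * D.etaS := by
    have h3 : (D.sigma ^ i) D.etaS = D.etaS := (D.sigma ^ i).commutes _
    rw [omega, map_add, map_mul, map_one, h3]
    ring
  have h4 : algebraMap (CycInt p) D.ExtRing (∑ j ∈ Finset.range i, rho p ^ j) * D.etaS
      = D.rhoS ^ i - 1 := by
    rw [etaS, etaR, ← algebraMap_extRing, ← map_mul, ← rho_pow_sub_one, map_sub, map_pow, map_one,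
      rhoS]
  rw [← h2, h1]
  linear_combination D.omega * h4

theorem isUnit_theta_sub {i : ℕ} (hi : ¬ p ∣ i) : IsUnit (D.theta - (D.sigma ^ i) D.theta) := by
  rw [theta_sub_sigma_pow_theta]
  exact (((isUnit_geom_sum_rho hi).map _).mul D.isUnit_omega).neg

/-- The fixed elements of `σ`. Write `b = h(θ)` with `h ∈ R[X]` of degree `< p`; if `b` is fixed,
then `h - b` vanishes at the `p` elements `σ ^ i θ`, whose differences are units, and the
Vandermonde determinant shows that `h` is the constant `b`. -/
theorem exists_algebraMap_eq_of_sigma_eq (b : D.ExtRing) (hb : D.sigma b = b) :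
    ∃ a, algebraMap D.BaseRing D.ExtRing a = b := by
  have hbi : ∀ i : ℕ, (D.sigma ^ i) b = b := by
    intro i
    induction i with
    | zero => rfl
    | succ i ih => rw [pow_succ, AlgEquiv.mul_apply, hb, ih]
  obtain ⟨q, rfl⟩ := AdjoinRoot.mk_surjective b
  have hmod : AdjoinRoot.mk D.poly (q %ₘ D.poly) = AdjoinRoot.mk D.poly q := by
    refine AdjoinRoot.mk_eq_mk.2 ⟨-(q /ₘ D.poly), ?_⟩
    rw [modByMonic_eq_sub_mul_div]; ring
  rw [← hmod] at hbi ⊢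
  have hdeg : (q %ₘ D.poly).natDegree < p := by
    have := natDegree_modByMonic_lt q D.poly_monic (fun h => by
      have := D.poly_natDegree
      rw [h, natDegree_one] at this
      exact hp.out.ne_zero this.symm)
    rwa [poly_natDegree] at this
  generalize q %ₘ D.poly = h at hbi hdeg ⊢
  obtain ⟨k, hk⟩ : ∃ k, p = k + 1 := ⟨p - 1, by have := hp.out.pos; omega⟩
  let v : Fin (k + 1) → D.ExtRing := fun i => (D.sigma ^ (i : ℕ)) D.theta
  let c : Fin (k + 1) → D.ExtRing :=
    fun i => algebraMap _ _ (h.coeff i) - if i = 0 then AdjoinRoot.mk D.poly h else 0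
  have hdet : IsUnit (Matrix.vandermonde v) := by
    rw [Matrix.isUnit_iff_isUnit_det, Matrix.det_vandermonde]
    refine IsUnit.prod_iff.2 fun i _ => IsUnit.prod_iff.2 fun j hj => ?_
    have hij : (i : ℕ) < j := Fin.lt_def.1 (Finset.mem_Ioi.1 hj)
    have h1 : v j - v i = (D.sigma ^ (i : ℕ)) (-(D.theta - (D.sigma ^ (j - i : ℕ)) D.theta)) := by
      rw [map_neg, map_sub, ← AlgEquiv.mul_apply, ← pow_add, Nat.add_sub_cancel' hij.le]
      ring
    rw [h1]
    refine (D.isUnit_theta_sub fun hd => ?_).neg.map _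
    have := Nat.le_of_dvd (by omega) hd
    omega
  have hv : (Matrix.vandermonde v).mulVec c = 0 := by
    ext i
    have h1 : (D.sigma ^ (i : ℕ)) (AdjoinRoot.mk D.poly h)
        = ∑ j : Fin (k + 1), v i ^ (j : ℕ) * algebraMap _ _ (h.coeff j) := by
      have h2 : AdjoinRoot.mk D.poly h = aeval D.theta h := (AdjoinRoot.aeval_eq h).symm
      rw [h2, ← AlgEquiv.coe_toAlgHom, ← aeval_algHom_apply,
        aeval_eq_sum_range' (hk ▸ hdeg : h.natDegree < k + 1), Finset.sum_range]
      refine Finset.sum_congr rfl fun j _ => ?_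
      rw [Algebra.smul_def, mul_comm]
      rfl
    rw [hbi] at h1
    simp only [Matrix.mulVec, dotProduct, Matrix.vandermonde_apply, c, mul_sub,
      Finset.sum_sub_distrib, ← h1, Pi.zero_apply, mul_ite, mul_zero, Finset.sum_ite_eq',
      Finset.mem_univ, if_true, Fin.val_zero, pow_zero, one_mul, sub_self]
  have hc : c = 0 := Matrix.mulVec_injective_of_isUnit hdet (hv.trans (Matrix.mulVec_zero _).symm)
  refine ⟨h.coeff 0, ?_⟩
  have := congrFun hc 0
  simpa [c, sub_eq_zero] using this

theorem isGaloisWithGroup_sigma :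
    IsGaloisWithGroup D.BaseRing D.ExtRing (Subgroup.zpowers D.sigma) :=
  isGaloisWithGroup_zpowers hp.out D.algebraMap_extRing_injective D.sigma D.sigma_pow
    (fun _ hi => Ideal.eq_top_of_isUnit_mem _ (Ideal.subset_span ⟨D.theta, rfl⟩)
      (D.isUnit_theta_sub hi))
    D.exists_algebraMap_eq_of_sigma_eq

/-- `R → S`, twisted by the automorphism `τ` of `R`. -/
noncomputable def twistedMap : D.BaseRing →+* D.ExtRing :=
  (algebraMap D.BaseRing D.ExtRing).comp (D.τR : D.BaseRing →+* D.BaseRing)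

theorem twistedMap_apply (a : D.BaseRing) :
    D.twistedMap a = algebraMap D.BaseRing D.ExtRing (D.τR a) := rfl

theorem isUnit_deltaR : IsUnit D.deltaR := D.isUnit_delta.map _

/-- `(1 + z η ^ p) ^ r (1 + τ(θ) τ(η)) = ω ^ s`. -/
theorem kummerC_pow_mul_tauTheta :
    algebraMap D.BaseRing D.ExtRing D.kummerC ^ D.r * (1 + D.tauTheta * D.twistedMap D.etaR)
      = D.omega ^ D.s := by
  have hp1 : p - 1 + 1 = p := Nat.sub_add_cancel hp.out.one_lt.le
  have hw : 1 + algebraMap D.BaseRing D.ExtRing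
      (starOp (D.etaR ^ p) D.r D.z * D.etaR ^ (p - 1)) * D.etaS
      = algebraMap D.BaseRing D.ExtRing D.kummerC ^ D.r := by
    rw [etaS, ← map_mul, mul_assoc, ← pow_succ, hp1, ← map_pow, kummerC, ← one_add_starOp,
      map_add, map_one]
  have hu : IsUnit (1 + algebraMap D.BaseRing D.ExtRing
      (starOp (D.etaR ^ p) D.r D.z * D.etaR ^ (p - 1)) * D.etaS) := by
    rw [hw]
    exact (D.isUnit_one_add_z.map _).pow _
  have hδ := D.isUnit_deltaR.map (algebraMap D.BaseRing D.ExtRing)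
  have h1 : algebraMap D.BaseRing D.ExtRing D.deltaR * D.tauTheta =
      ominus D.etaS (starOp D.etaS D.s D.theta) (algebraMap D.BaseRing D.ExtRing
        (starOp (D.etaR ^ p) D.r D.z * D.etaR ^ (p - 1))) := by
    rw [tauTheta, Ring.mul_inverse_cancel_left _ _ hδ]
    rfl
  have h2 := (ominus_eq_iff _ _ _ _ hu).1 h1.symm
  have h3 := congrArg (fun x => 1 + x * D.etaS) h2
  simp only [one_add_starOp, one_add_oplus, hw] at h3
  rw [omega, h3, twistedMap_apply, τR_etaR, map_mul, ← etaS]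
  ring

theorem eval₂_tauTheta : D.poly.eval₂ D.twistedMap D.tauTheta = 0 := by
  have h := D.eval₂_poly_mul D.twistedMap D.tauTheta
  have h1 := congrArg (· ^ p) D.kummerC_pow_mul_tauTheta
  simp only [mul_pow] at h1
  rw [← pow_mul, ← pow_mul, mul_comm D.s, pow_mul D.omega, omega_pow, ← map_pow _ (D.partialNorm _),
    partialNorm_pow_s,
    map_mul, map_pow, mul_comm p, mul_comm] at h1
  have h2 := ((D.isUnit_one_add_z.map (algebraMap D.BaseRing D.ExtRing)).pow
    (D.r * p)).mul_right_cancel h1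
  rw [h2, ← twistedMap_apply, sub_self, twistedMap_apply, ← map_pow] at h
  refine D.mul_algebraMap_cancel (pow_ne_zero p ?_) (h.trans (zero_mul _).symm)
  exact (map_ne_zero_iff _ D.τR.injective).2 D.etaR_ne_zero

/-- `τ` on `S`, as a homomorphism. -/
noncomputable def tauHom : D.ExtRing →+* D.ExtRing :=
  AdjoinRoot.lift D.twistedMap D.tauTheta D.eval₂_tauTheta

theorem tauHom_theta : D.tauHom D.theta = D.tauTheta := AdjoinRoot.lift_root _

theorem tauHom_algebraMap (a : D.BaseRing) :
    D.tauHom (algebraMap D.BaseRing D.ExtRing a) = algebraMap D.BaseRing D.ExtRing (D.τR a) :=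
  AdjoinRoot.lift_of _

theorem tauHom_rhoS : D.tauHom D.rhoS = D.rhoS ^ D.s := by
  rw [rhoS, algebraMap_extRing, tauHom_algebraMap, τR_algebraMap, D.τ_rho, map_pow, map_pow]

/-- `τ(ω) = ω ^ s / (1 + z η ^ p) ^ r`. -/
theorem tauHom_omega :
    D.tauHom D.omega * algebraMap D.BaseRing D.ExtRing D.kummerC ^ D.r = D.omega ^ D.s := by
  rw [← kummerC_pow_mul_tauTheta, mul_comm]
  congr 1
  rw [omega, map_add, map_mul, map_one, tauHom_theta, etaS, tauHom_algebraMap, twistedMap_apply]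

theorem tauHom_pow_algebraMap (k : ℕ) (a : D.BaseRing) :
    (D.tauHom ^ k) (algebraMap D.BaseRing D.ExtRing a)
      = algebraMap D.BaseRing D.ExtRing ((D.τR ^ k) a) := by
  induction k with
  | zero => rfl
  | succ k ih =>
    rw [pow_succ', pow_succ', RingAut.mul_apply, ← tauHom_algebraMap, ← ih]
    rfl

theorem tauHom_pow_omega (k : ℕ) :
    (D.tauHom ^ k) D.omega * algebraMap D.BaseRing D.ExtRing (D.partialNorm k) ^ D.r
      = D.omega ^ D.s ^ k := by
  induction k with
  | zero => simp [partialNorm]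
  | succ k ih =>
    have h := congrArg D.tauHom ih
    rw [map_mul, map_pow, map_pow, tauHom_algebraMap] at h
    rw [← τR_partialNorm_mul, map_mul, map_pow, mul_pow, ← mul_assoc, pow_succ', RingHom.mul_def,
      RingHom.comp_apply, h, pow_succ', pow_mul, ← tauHom_omega]
    ring

theorem tauHom_pow : D.tauHom ^ (p - 1) = 1 := by
  have hω : (D.tauHom ^ (p - 1)) D.omega = D.omega := by
    have h := D.tauHom_pow_omega (p - 1)
    rw [D.s_pow, pow_add, pow_one, pow_mul, omega_pow] at h
    exact (((D.isUnit_partialNorm _).map _).pow _).mul_right_cancel h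
  have hR : ∀ a : D.BaseRing, (D.tauHom ^ (p - 1)) (algebraMap D.BaseRing D.ExtRing a)
      = algebraMap D.BaseRing D.ExtRing a := by
    intro a
    rw [tauHom_pow_algebraMap, τR_pow]
    rfl
  refine AdjoinRoot.ringHom_ext (RingHom.ext hR) ?_
  rw [omega, map_add, map_mul, map_one, etaS, hR] at hω
  exact D.mul_etaS_cancel (add_left_cancel hω)

/-- The automorphism `τ` of `S`. -/
noncomputable def tau : D.ExtRing ≃+* D.ExtRing :=
  RingEquiv.ofRingHom D.tauHom (D.tauHom ^ (p - 2))
    ((pow_succ' D.tauHom (p - 2)).symm.trans (by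
      rw [show p - 2 + 1 = p - 1 by have := hp.out.two_le; omega, tauHom_pow]; rfl))
    ((pow_succ D.tauHom (p - 2)).symm.trans (by
      rw [show p - 2 + 1 = p - 1 by have := hp.out.two_le; omega, tauHom_pow]; rfl))

theorem tau_pow : D.tau ^ (p - 1) = 1 := by
  have h : ∀ k b, (D.tau ^ k) b = (D.tauHom ^ k) b := by
    intro k
    induction k with
    | zero => intro b; rfl
    | succ k ih =>
      intro b
      rw [pow_succ', pow_succ', RingAut.mul_apply, ih]
      rfl
  refine RingEquiv.ext fun b => ?_
  rw [h, tauHom_pow]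
  rfl

theorem tau_sigma (b : D.ExtRing) : D.tau (D.sigma b) = D.sigma (D.tau b) := by
  let σ : D.ExtRing →+* D.ExtRing := (D.sigmaHom : D.ExtRing →+* D.ExtRing)
  have hσR : ∀ a : D.BaseRing, σ (algebraMap _ _ a) = algebraMap _ _ a := D.sigmaHom.commutes
  have hσω : σ D.omega = D.rhoS * D.omega := D.sigmaHom_omega
  have hc : IsUnit (algebraMap D.BaseRing D.ExtRing D.kummerC ^ D.r) :=
    (D.isUnit_one_add_z.map (algebraMap D.BaseRing D.ExtRing)).pow _
  have hω : D.tauHom (σ D.omega) = σ (D.tauHom D.omega) := by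
    have h := congrArg σ D.tauHom_omega
    rw [map_mul, map_pow, map_pow, hσR, hσω, mul_pow, ← tauHom_omega, ← mul_assoc] at h
    rw [hσω, map_mul, tauHom_rhoS]
    exact (hc.mul_right_cancel h).symm
  have hR : ∀ a : D.BaseRing,
      D.tauHom (σ (algebraMap _ _ a)) = σ (D.tauHom (algebraMap _ _ a)) := by
    intro a
    rw [hσR, tauHom_algebraMap, hσR]
  have h : D.tauHom.comp σ = σ.comp D.tauHom := by
    refine AdjoinRoot.ringHom_ext (RingHom.ext hR) ?_
    change D.tauHom (σ D.theta) = σ (D.tauHom D.theta)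
    rw [omega, map_add, map_mul, map_one, map_add, map_mul, map_one, map_add, map_mul, map_one,
      map_add, map_mul, map_one, etaS, ← hR, hσR, tauHom_algebraMap] at hω
    refine D.mul_algebraMap_cancel ?_ (add_left_cancel hω)
    exact (map_ne_zero_iff _ D.τR.injective).2 D.etaR_ne_zero
  exact RingHom.congr_fun h b

end TauData

end MixedArtinSchreier

open MixedArtinSchreier in
theorem proposition2p6 (p : ℕ) [Fact p.Prime] (D : TauData p) :
    ∃ (σ : D.ExtRing ≃ₐ[D.BaseRing] D.ExtRing) (τ : D.ExtRing ≃+* D.ExtRing)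
      (hτ : ∀ a : D.BaseRing,
        τ (algebraMap D.BaseRing D.ExtRing a) = algebraMap D.BaseRing D.ExtRing (D.τR a)),
      σ D.theta = algebraMap (CycInt p) D.ExtRing (rho p) * D.theta + 1 ∧
      IsGaloisWithGroup D.BaseRing D.ExtRing (Subgroup.zpowers σ) ∧
      τ D.theta = D.tauTheta ∧
      τ ^ (p - 1) = 1 ∧
      (∀ a : D.ExtRing, τ (σ a) = σ (τ a)) ∧
      (letI := fixedAlgebra D.τR τ hτ
        ∃ σ' : fixedSubring τ ≃ₐ[fixedSubring D.τR] fixedSubring τ,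
          (∀ a : fixedSubring τ, ((σ' a : fixedSubring τ) : D.ExtRing) = σ (a : D.ExtRing)) ∧
          Nat.card (Subgroup.zpowers σ') = p ∧
          IsGaloisWithGroup (fixedSubring D.τR) (fixedSubring τ) (Subgroup.zpowers σ')) ∧
      (p ≠ 2 → ¬ Algebra.FormallyUnramified (fixedSubring D.τR) D.BaseRing) := by
  have hp : p.Prime := Fact.out
  have hpm : ¬ p ∣ p - 1 := fun h => by
    have := Nat.le_of_dvd (Nat.sub_pos_of_lt hp.one_lt) h
    have := hp.pos
    omega
  exact ⟨D.sigma, D.tau, D.tauHom_algebraMap, D.sigma_theta, D.isGaloisWithGroup_sigma,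
    D.tauHom_theta, D.tau_pow, D.tau_sigma,
    exists_isGaloisWithGroup_fixedSubring D.algebraMap_extRing_injective D.τR D.tau
      D.tauHom_algebraMap hp D.sigma D.sigma_pow (fun _ => D.isUnit_theta_sub)
      D.exists_algebraMap_eq_of_sigma_eq (Nat.sub_pos_of_lt hp.one_lt) hpm D.tau_pow D.tau_sigma,
    D.not_formallyUnramified⟩
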